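/- Let $T\ge 0$, let $V$ be a finite-dimensional real inner product space, and let $\gamma:[0,T]\to V$ be a continuous path of bounded variation, with Lebesgue–Stieltjes measure $d\gamma$. Let $\mathbb{K}$ be $\mathbb{R}$ or $\mathbb{C}$. Then the functional equation $$K(s,t)=1-\int_s^t\int_s^r K(s,u)\,K(u,r)\,\langle d\gamma_u,d\gamma_r\rangle,\qquad K(s,s)=K(t,t)=1,\qquad 0\le s\le t\le T,$$ has a unique solution $K:\{(s,t):0\le s\le t\le T\}\to\mathbb{K}$. Here $\langle d\gamma_u,d\gamma_r\rangle=\sum_j d\gamma^j_u\,d\gamma^j_r$ (coordinates in an orthonormal basis of $V$) is the signed product measure with mass $\langle d\gamma(A),d\gamma(B)\rangle$ on $A\times B$. A solution is a function $K$ such that for all $0\le s\le t\le T$ the function $(u,r)\mapsto K(s,u)K(u,r)$ is integrable on $\{s\le u\le r\le t\}$ with respect to the total variation of this signed measure and the two displayed equations hold. More precisely, a solution exists that is continuous on $\{0\le s\le t\le T\}$, and every solution agrees with it on $\{0\le s\le t\le T\}$. -/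

import Mathlib

open MeasureTheory Set

noncomputable section

/-- Extending a path of bounded variation on `[0, T]` to the whole line by its endpoint values
gives a function of bounded variation. -/
theorem boundedVariationOn_comp_projIcc {V : Type*} [NormedAddCommGroup V] {T : ℝ} (hT : 0 ≤ T)
    {γ : ℝ → V} (hγ : BoundedVariationOn γ (Icc 0 T)) :
    BoundedVariationOn (fun t : ℝ => γ (projIcc 0 T hT t)) univ :=
  ne_top_of_le_ne_top hγ
    (eVariationOn.comp_le_of_monotoneOn γ (t := univ) (fun t : ℝ => (projIcc 0 T hT t : ℝ))
      (fun _ _ _ _ h => monotone_projIcc hT h) (fun t _ => (projIcc 0 T hT t).2))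

/-- The `V`-valued Lebesgue-Stieltjes measure `dγ` of a path `γ` of bounded variation on `[0, T]`:
for continuous `γ` it gives mass `γ b - γ a` to `[a, b] ⊆ [0, T]`, and no mass to the complement
of `[0, T]`. -/
def pathMeasure {V : Type*} [NormedAddCommGroup V]
    [InnerProductSpace ℝ V]
    [FiniteDimensional ℝ V] {T : ℝ} (hT : 0 ≤ T) {γ : ℝ → V}
    (hγ : BoundedVariationOn γ (Icc 0 T)) : VectorMeasure ℝ V :=
  haveI : CompleteSpace V := FiniteDimensional.complete ℝ V
  (boundedVariationOn_comp_projIcc hT hγ).vectorMeasure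

/-- For continuous `γ`, the measure `dγ` gives mass `γ b - γ a` to `[a, b] ⊆ [0, T]`. -/
theorem pathMeasure_Icc {V : Type*} [NormedAddCommGroup V]
    [InnerProductSpace ℝ V]
    [FiniteDimensional ℝ V] {T : ℝ} (hT : 0 ≤ T) {γ : ℝ → V}
    (hγ : BoundedVariationOn γ (Icc 0 T)) (hc : ContinuousOn γ (Icc 0 T)) {a b : ℝ} (ha : 0 ≤ a)
    (hab : a ≤ b) (hb : b ≤ T) : pathMeasure hT hγ (Icc a b) = γ b - γ a := by
  have : CompleteSpace V := FiniteDimensional.complete ℝ V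
  have hcont : Continuous (fun t : ℝ => γ (projIcc 0 T hT t)) :=
    hc.comp_continuous (by fun_prop) (fun t => (projIcc 0 T hT t).2)
  have hr := (hcont.continuousAt (x := b)).continuousWithinAt (s := Ici b) |>.rightLim_eq
  have hl := (hcont.continuousAt (x := a)).continuousWithinAt (s := Iic a) |>.leftLim_eq
  rw [pathMeasure, BoundedVariationOn.vectorMeasure_Icc _ hab, hr, hl,
    projIcc_of_mem hT ⟨ha, hab.trans hb⟩, projIcc_of_mem hT ⟨ha.trans hab, hb⟩]

/-- `dγ` has finite total variation, so that its product with itself exists. -/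
instance isFiniteMeasure_variation_pathMeasure {V : Type*} [NormedAddCommGroup V]
    [InnerProductSpace ℝ V]
    [FiniteDimensional ℝ V] {T : ℝ} (hT : 0 ≤ T) {γ : ℝ → V}
    (hγ : BoundedVariationOn γ (Icc 0 T)) : IsFiniteMeasure (pathMeasure hT hγ).variation := by
  set b := stdOrthonormalBasis ℝ V
  set μ := pathMeasure hT hγ
  let ν : Fin (Module.finrank ℝ V) → SignedMeasure ℝ := fun i =>
    μ.mapRange (innerSL ℝ (b i)).toLinearMap.toAddMonoidHom (innerSL ℝ (b i)).continuous
  have hν : ∀ i A, ν i A = inner ℝ (b i) (μ A) := fun i A => rfl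
  refine isFiniteMeasure_of_le (∑ i, (ν i).totalVariation) ?_
  refine VectorMeasure.variation_le_of_forall_enorm_le fun A hA => ?_
  calc ‖μ A‖ₑ = ‖∑ i, inner ℝ (b i) (μ A) • b i‖ₑ := by rw [b.sum_repr']
    _ ≤ ∑ i, ‖inner ℝ (b i) (μ A) • b i‖ₑ := enorm_sum_le _ _
    _ = ∑ i, ‖ν i A‖ₑ := by
      refine Finset.sum_congr rfl fun i _ => ?_
      rw [enorm_smul, hν, ← ofReal_norm (b i), b.norm_eq_one]; simp
    _ ≤ ∑ i, (ν i).totalVariation A :=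
      Finset.sum_le_sum fun i _ => SignedMeasure.enorm_le_totalVariation _ _
    _ = _ := by simp

/-- The signed measure `⟨dγ_u, dγ_r⟩ = ∑ j, dγ_u^j dγ_r^j` on the plane: the product of `dγ` with
itself, paired by the inner product of `V`. -/
def innerPathMeasure {V : Type*} [NormedAddCommGroup V]
    [InnerProductSpace ℝ V]
    [FiniteDimensional ℝ V] {T : ℝ} (hT : 0 ≤ T) {γ : ℝ → V}
    (hγ : BoundedVariationOn γ (Icc 0 T)) : SignedMeasure (ℝ × ℝ) :=
  (pathMeasure hT hγ).prod (pathMeasure hT hγ) (innerSL ℝ)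

/-- `⟨dγ_u, dγ_r⟩` gives mass `⟨dγ(A), dγ(B)⟩` to `A × B`. -/
theorem innerPathMeasure_prod {V : Type*} [NormedAddCommGroup V]
    [InnerProductSpace ℝ V]
    [FiniteDimensional ℝ V] {T : ℝ} (hT : 0 ≤ T) {γ : ℝ → V}
    (hγ : BoundedVariationOn γ (Icc 0 T)) (A B : Set ℝ) :
    innerPathMeasure hT hγ (A ×ˢ B) = inner ℝ (pathMeasure hT hγ A) (pathMeasure hT hγ B) := by
  unfold innerPathMeasure
  rw [VectorMeasure.prod_apply]; rfl

/-- The domain `s ≤ u ≤ r ≤ t` of the points `(u, r)`. -/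
def orderedPairs (s t : ℝ) : Set (ℝ × ℝ) :=
  {p | s ≤ p.1 ∧ p.1 ≤ p.2 ∧ p.2 ≤ t}

/-- `K` solves `K(s,t) = 1 - ∫_s^t ∫_s^r K(s,u) K(u,r) ⟨dγ_u, dγ_r⟩`, `K(s,s) = 1`, on
`0 ≤ s ≤ t ≤ T`. The double integral is required to exist (absolutely); nothing else is asked of
`K`, and its values off `0 ≤ s ≤ t ≤ T` play no role. -/
structure SolvesFunctionalEquation {𝕜 : Type*} [RCLike 𝕜] {V : Type*} [NormedAddCommGroup V]
    [InnerProductSpace ℝ V] [FiniteDimensional ℝ V] {T : ℝ} (hT : 0 ≤ T) {γ : ℝ → V}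
    (hγ : BoundedVariationOn γ (Icc 0 T)) (K : ℝ → ℝ → 𝕜) : Prop where
  integrableOn : ∀ s t : ℝ, 0 ≤ s → s ≤ t → t ≤ T →
    (innerPathMeasure hT hγ).IntegrableOn (fun p => K s p.1 * K p.1 p.2) (orderedPairs s t)
  eq_one_sub : ∀ s t : ℝ, 0 ≤ s → s ≤ t → t ≤ T →
    K s t = 1 - ∫ᵛ p in orderedPairs s t, K s p.1 * K p.1 p.2 ∂<•(innerPathMeasure hT hγ)
  diag : ∀ s : ℝ, 0 ≤ s → s ≤ T → K s s = 1

end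

open Filter Topology

/-! Write `ν` for `⟨dγ_u, dγ_r⟩` and `μ` for the variation of `dγ`. The argument uses only `|ν| ≤ μ
× μ` with `μ` finite and atomless (`variation_innerPathMeasure_le`,
`nullSingletonClass_variation_pathMeasure`).

Existence (`exists_continuous_solution`) is a Banach fixed point. Substituting `K(s,t) = (w t / w s)
k(s,t)` preserves the shape of the equation, because the weights in `K(s,u) K(u,r)` telescope. For
`w` growing fast enough the quadratic term is so small that the unit ball is mapped to itself
contractively.

For uniqueness (`eq_of_continuousOn`) the difficulty is that a competitor `K₂` is neither bounded
nor jointly measurable a priori; only the products `K₂(s,u) K₂(u,r)` are integrable. Dominated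
convergence makes `K₂(s,·)` continuous. If `K₂` equals the continuous solution `K₁` up to time `σ`,
dividing the product by a factor that stays away from `0` shows that `K₂` itself is integrable up to
some `b > σ` (`exists_integrableOn_extension`). On a thin strip `σ < r ≤ τ` this integrability
bounds `K₂`, and a contraction estimate then gives `K₂ = K₁` up to `τ` (`exists_eq_extension`).
Continuous induction on `σ` finishes. -/

theorem isClosed_orderedPairs (s t : ℝ) : IsClosed (orderedPairs s t) :=
  (isClosed_le continuous_const continuous_fst).inter
    ((isClosed_le continuous_fst continuous_snd).inter (isClosed_le continuous_snd continuous_const))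

theorem measurableSet_orderedPairs (s t : ℝ) : MeasurableSet (orderedPairs s t) :=
  (isClosed_orderedPairs s t).measurableSet

theorem isCompact_orderedPairs (s t : ℝ) : IsCompact (orderedPairs s t) :=
  (isCompact_Icc.prod isCompact_Icc).of_isClosed_subset (isClosed_orderedPairs s t)
    fun p hp => (⟨⟨hp.1, hp.2.1.trans hp.2.2⟩, ⟨hp.1.trans hp.2.1, hp.2.2⟩⟩ :
      p ∈ Icc s t ×ˢ Icc s t)

theorem orderedPairs_subset {s s' t t' : ℝ} (hs : s' ≤ s) (ht : t ≤ t') :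
    orderedPairs s t ⊆ orderedPairs s' t' :=
  fun _ hp => ⟨hs.trans hp.1, hp.2.1, hp.2.2.trans ht⟩

/-! ### Integrals against a signed measure, controlled by its variation. -/

namespace MeasureTheory.VectorMeasure

theorem integrableOn_iff_variation {X F E : Type*} [MeasurableSpace X] [NormedAddCommGroup F]
    [NormedAddCommGroup E] {ν : VectorMeasure X F} {A : Set X} (hA : MeasurableSet A) {f : X → E} :
    ν.IntegrableOn f A ↔ MeasureTheory.IntegrableOn f A ν.variation := by
  rw [VectorMeasure.IntegrableOn, VectorMeasure.Integrable, variation_restrict hA,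
    MeasureTheory.IntegrableOn]

theorem norm_setIntegral_le_setIntegral_norm {X E : Type*} [MeasurableSpace X]
    [NormedAddCommGroup E] [NormedSpace ℝ E] (ν : SignedMeasure X) {A : Set X}
    (hA : MeasurableSet A) (f : X → E) :
    ‖∫ᵛ x in A, f x ∂<•ν‖ ≤ ∫ x in A, ‖f x‖ ∂ν.variation := by
  refine norm_integral_le_integral_norm.trans ?_
  rw [variation_restrict hA, ContinuousLinearMap.opNorm_flip]
  exact mul_le_of_le_one_left (integral_nonneg fun _ => norm_nonneg _)
    ContinuousLinearMap.opNorm_lsmul_le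

end MeasureTheory.VectorMeasure

/-! ### Exponential weights for atomless measures. -/

section Weight

variable {μ : Measure ℝ} [IsFiniteMeasure μ] [NullSingletonClass μ]

/-- For an atomless finite measure there are exponential weights whose integral over any interval
is at most a prescribed multiple of their increment. -/
theorem exists_weight_intervalIntegral_le (μ : Measure ℝ) [IsFiniteMeasure μ] [NullSingletonClass μ] {c : ℝ}
    (hc : 0 < c) :
    ∃ w : ℝ → ℝ, Continuous w ∧ Monotone w ∧ (∀ t, 0 < w t) ∧
      ∀ s t, s ≤ t → ∫ r in s..t, w r ∂μ ≤ c * (w t - w s) := by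
  set F : ℝ → ℝ := fun t => ∫ _ in (0 : ℝ)..t, (1 : ℝ) ∂μ with hF
  have hint : ∀ a b, IntervalIntegrable (fun _ => (1 : ℝ)) μ a b := fun a b =>
    intervalIntegrable_const
  have hFc : Continuous F := intervalIntegral.continuous_primitive hint 0
  have hFsub : ∀ s t, s ≤ t → F t - F s = μ.real (Ioc s t) := by
    intro s t hst
    rw [hF]
    simp only
    rw [intervalIntegral.integral_interval_sub_left (hint _ _) (hint _ _),
      intervalIntegral.integral_of_le hst]
    simp
  have hFm : Monotone F := fun s t hst => by
    have := hFsub s t hst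
    have h0 : 0 ≤ μ.real (Ioc s t) := measureReal_nonneg
    linarith
  -- Rate `1 / c` would be the differential heuristic; the extra factor `2` pays for bounding `w` on
  -- a short interval by twice its left endpoint value.
  set w : ℝ → ℝ := fun t => Real.exp (2 / c * F t) with hw
  have hwc : Continuous w := by fun_prop
  have hwm : Monotone w := fun s t hst => by
    have := hFm hst
    simp only [hw]
    gcongr
  have hwpos : ∀ t, 0 < w t := fun t => Real.exp_pos _
  have hwint : ∀ a b, IntervalIntegrable w μ a b := fun a b => hwc.intervalIntegrable a b
  refine ⟨w, hwc, hwm, hwpos, fun s t hst => ?_⟩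
  -- Continuous induction in the right endpoint replaces the chain rule for the Stieltjes function
  -- `F`.
  have hcl : IsClosed ({r | ∫ x in s..r, w x ∂μ ≤ c * (w r - w s)} ∩ Icc s t) := by
    refine IsClosed.inter (isClosed_le ?_ (by fun_prop)) isClosed_Icc
    exact intervalIntegral.continuous_primitive hwint s
  refine hcl.Icc_subset_of_forall_exists_gt (by simp) ?_ (right_mem_Icc.2 hst)
  rintro x ⟨hx, -⟩ y (hy : x < y)
  have hev : ∀ᶠ z in 𝓝[>] x, w z < 2 * w x :=
    (hwc.continuousAt.eventually_lt continuousAt_const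
      (by linarith [hwpos x])).filter_mono nhdsWithin_le_nhds
  obtain ⟨z, hz, hzm⟩ := (hev.and (Ioc_mem_nhdsGT hy)).exists
  refine ⟨z, ?_, hzm⟩
  have h1 : ∫ r in x..z, w r ∂μ ≤ w z * μ.real (Ioc x z) := by
    rw [intervalIntegral.integral_of_le hzm.1.le]
    refine (setIntegral_mono_on (hwint x z).1 (integrableOn_const (by finiteness))
      measurableSet_Ioc (fun r hr => hwm hr.2)).trans (le_of_eq ?_)
    simp [mul_comm]
  have h2 : w x * (2 / c * μ.real (Ioc x z)) ≤ w z - w x := by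
    have e : w z = w x * Real.exp (2 / c * μ.real (Ioc x z)) := by
      rw [← hFsub x z hzm.1.le, hw]
      simp only
      rw [← Real.exp_add]
      ring_nf
    rw [e]
    have := Real.add_one_le_exp (2 / c * μ.real (Ioc x z))
    nlinarith [hwpos x]
  have h3 : w z * μ.real (Ioc x z) ≤ c * (w z - w x) := by
    calc w z * μ.real (Ioc x z) ≤ 2 * w x * μ.real (Ioc x z) := by gcongr
      _ = c * (w x * (2 / c * μ.real (Ioc x z))) := by field_simp
      _ ≤ _ := by gcongr
  change ∫ r in s..z, w r ∂μ ≤ c * (w z - w s)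
  rw [← intervalIntegral.integral_add_adjacent_intervals (hwint s x) (hwint x z)]
  have hx' : ∫ r in s..x, w r ∂μ ≤ c * (w x - w s) := hx
  linarith

/-- Dropping `s ≤ u ≤ r` leaves a product, in which `u` contributes the total mass `m`. The choice
`c = 1 / (4 * m + 1)` absorbs it and also covers `m = 0`. -/
theorem exists_weight_setIntegral_orderedPairs_le {N : Measure (ℝ × ℝ)} (hN : N ≤ μ.prod μ) :
    ∃ w : ℝ → ℝ, Continuous w ∧ Monotone w ∧ (∀ t, 0 < w t) ∧
      ∀ s t, s ≤ t → ∫ p in orderedPairs s t, w p.2 ∂N ≤ 1 / 4 * (w t - w s) := by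
  set m : ℝ := μ.real univ
  have hm : 0 ≤ m := measureReal_nonneg
  obtain ⟨w, hwc, hwm, hwpos, hw⟩ := exists_weight_intervalIntegral_le μ
    (c := 1 / (4 * m + 1)) (by positivity)
  refine ⟨w, hwc, hwm, hwpos, fun s t hst => ?_⟩
  have hint : IntegrableOn (fun p : ℝ × ℝ => w p.2) (univ ×ˢ Icc s t) (μ.prod μ) := by
    refine Measure.integrableOn_of_bounded (M := w t) (by finiteness) (by fun_prop) ?_
    refine (ae_restrict_iff' (MeasurableSet.univ.prod measurableSet_Icc)).2 (.of_forall ?_)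
    rintro p ⟨-, hp⟩
    rw [Real.norm_of_nonneg (hwpos _).le]
    exact hwm hp.2
  have hle : N.restrict (orderedPairs s t) ≤ (μ.prod μ).restrict (univ ×ˢ Icc s t) :=
    Measure.restrict_mono (fun p (hp : p ∈ orderedPairs s t) =>
      (⟨mem_univ _, hp.1.trans hp.2.1, hp.2.2⟩ : p ∈ univ ×ˢ Icc s t)) hN
  calc ∫ p in orderedPairs s t, w p.2 ∂N
      ≤ ∫ p in univ ×ˢ Icc s t, w p.2 ∂(μ.prod μ) :=
        integral_mono_measure hle (.of_forall fun p => (hwpos _).le) hint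
    _ = m * ∫ r in s..t, w r ∂μ := by
        have := setIntegral_prod_mul (μ := μ) (ν := μ) (fun _ => (1 : ℝ)) w univ (Icc s t)
        simp only [one_mul] at this
        rw [this, intervalIntegral.integral_of_le hst, integral_Icc_eq_integral_Ioc]
        simp [m]
    _ ≤ m * (1 / (4 * m + 1) * (w t - w s)) := by gcongr; exact hw s t hst
    _ = m / (4 * m + 1) * (w t - w s) := by ring
    _ ≤ 1 / 4 * (w t - w s) := by
        have : 0 ≤ w t - w s := sub_nonneg.2 (hwm hst)
        gcongr ?_ * _
        rw [div_le_div_iff₀ (by positivity) (by norm_num)]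
        linarith

theorem ae_fst_ne {N : Measure (ℝ × ℝ)} (hN : N ≤ μ.prod μ) (a : ℝ) : ∀ᵐ p ∂N, p.1 ≠ a := by
  refine (Measure.absolutelyContinuous_of_le hN).ae_le (mem_ae_iff.2 ?_)
  have : {p : ℝ × ℝ | p.1 ≠ a}ᶜ = {a} ×ˢ univ := by ext; simp
  simp [this, Measure.prod_prod]

theorem ae_snd_ne {N : Measure (ℝ × ℝ)} (hN : N ≤ μ.prod μ) (a : ℝ) : ∀ᵐ p ∂N, p.2 ≠ a := by
  refine (Measure.absolutelyContinuous_of_le hN).ae_le (mem_ae_iff.2 ?_)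
  have : {p : ℝ × ℝ | p.2 ≠ a}ᶜ = univ ×ˢ {a} := by ext; simp
  simp [this, Measure.prod_prod]

end Weight

/-! ### The variation of `dγ` and of `⟨dγ_u, dγ_r⟩`. -/

section PathMeasure

variable {V : Type*} [NormedAddCommGroup V] [InnerProductSpace ℝ V] [FiniteDimensional ℝ V]
  {T : ℝ} (hT : 0 ≤ T) {γ : ℝ → V}

theorem nullSingletonClass_variation_pathMeasure (hγ : BoundedVariationOn γ (Icc 0 T))
    (hcont : ContinuousOn γ (Icc 0 T)) : NullSingletonClass (pathMeasure hT hγ).variation := by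
  have : CompleteSpace V := FiniteDimensional.complete ℝ V
  refine ⟨fun a => ?_⟩
  have hc : Continuous (fun t : ℝ => γ (projIcc 0 T hT t)) :=
    hcont.comp_continuous (by fun_prop) (fun t => (projIcc 0 T hT t).2)
  have h0 : pathMeasure hT hγ {a} = 0 := by
    rw [pathMeasure, BoundedVariationOn.vectorMeasure_singleton,
      (hc.continuousAt (x := a)).continuousWithinAt (s := Ici a) |>.rightLim_eq,
      (hc.continuousAt (x := a)).continuousWithinAt (s := Iic a) |>.leftLim_eq, sub_self]
  rw [VectorMeasure.variation_apply_eq_zero (measurableSet_singleton a)]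
  intro t ht _
  rcases subset_singleton_iff_eq.1 ht with rfl | rfl
  · simp
  · exact h0

theorem variation_innerPathMeasure_le (hγ : BoundedVariationOn γ (Icc 0 T)) :
    (innerPathMeasure hT hγ).variation ≤
      (pathMeasure hT hγ).variation.prod (pathMeasure hT hγ).variation := by
  refine VectorMeasure.variation_prod_le.trans (Measure.le_iff.2 fun s _ => ?_)
  rw [Measure.smul_apply, smul_eq_mul]
  refine mul_le_of_le_one_left (by simp) ?_
  rw [← ofReal_norm]
  exact ENNReal.ofReal_le_one.2 (norm_innerSL_le ℝ)

end PathMeasure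

/-! ### Existence of a continuous solution. -/

section Existence

variable {𝕜 : Type*} [RCLike 𝕜] {μ : Measure ℝ} [IsFiniteMeasure μ] [NullSingletonClass μ]
  {ν : SignedMeasure (ℝ × ℝ)}

omit [NullSingletonClass μ] in
theorem isFiniteMeasure_variation_of_le_prod (hν : ν.variation ≤ μ.prod μ) :
    IsFiniteMeasure ν.variation :=
  isFiniteMeasure_of_le _ hν

/-- Dominated convergence: as `q` varies near `q₀`, the indicator at `p` is locally constant unless
`p` lies on the line `p.1 = q₀.1` or `p.2 = q₀.2`. Both are null since `μ` is atomless, and the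
diagonal edge does not move. -/
theorem continuous_setIntegral_orderedPairs (hν : ν.variation ≤ μ.prod μ)
    {g : ℝ × ℝ → ℝ × ℝ → 𝕜} (hg : Continuous fun x : (ℝ × ℝ) × (ℝ × ℝ) => g x.1 x.2) {C : ℝ}
    (hC : 0 ≤ C) (hb : ∀ q, ∀ p ∈ orderedPairs q.1 q.2, ‖g q p‖ ≤ C) :
    Continuous fun q : ℝ × ℝ => ∫ᵛ p in orderedPairs q.1 q.2, g q p ∂<•ν := by
  have := isFiniteMeasure_variation_of_le_prod hν
  rw [continuous_iff_continuousAt]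
  intro q₀
  simp_rw [← VectorMeasure.integral_indicator (measurableSet_orderedPairs _ _)]
  refine VectorMeasure.continuousAt_of_dominated (bound := fun _ => C) ?_ ?_
    (integrable_const _) ?_
  · refine .of_forall fun q => AEStronglyMeasurable.indicator ?_ (measurableSet_orderedPairs _ _)
    exact (hg.comp (Continuous.prodMk continuous_const continuous_id)).aestronglyMeasurable
  · refine .of_forall fun q => .of_forall fun p => ?_
    by_cases hp : p ∈ orderedPairs q.1 q.2
    · rw [indicator_of_mem hp]
      exact hb q p hp
    · rwa [indicator_of_notMem hp, norm_zero]
  · filter_upwards [ae_fst_ne hν q₀.1, ae_snd_ne hν q₀.2] with p h1 h2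
    have hgp : ContinuousAt (fun q => g q p) q₀ :=
      (hg.comp (Continuous.prodMk continuous_id continuous_const)).continuousAt
    have c1 : ContinuousAt (fun q : ℝ × ℝ => q.1) q₀ := continuousAt_fst
    have c2 : ContinuousAt (fun q : ℝ × ℝ => q.2) q₀ := continuousAt_snd
    by_cases hp : p ∈ orderedPairs q₀.1 q₀.2
    · refine hgp.congr ?_
      filter_upwards [c1.eventually_lt continuousAt_const (lt_of_le_of_ne hp.1 h1.symm),
        continuousAt_const.eventually_lt c2 (lt_of_le_of_ne hp.2.2 h2)] with q hq1 hq2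
      rw [indicator_of_mem (show p ∈ orderedPairs q.1 q.2 from ⟨hq1.le, hp.2.1, hq2.le⟩)]
    · refine (continuousAt_const (y := (0 : 𝕜))).congr ?_
      have hev : ∀ᶠ q : ℝ × ℝ in 𝓝 q₀, p ∉ orderedPairs q.1 q.2 := by
        by_cases h : q₀.1 ≤ p.1
        · by_cases h' : p.1 ≤ p.2
          · have h'' : q₀.2 < p.2 := not_le.1 fun h'' => hp ⟨h, h', h''⟩
            filter_upwards [c2.eventually_lt continuousAt_const h''] with q hq hpq
            exact hq.not_ge hpq.2.2
          · exact .of_forall fun q hpq => h' hpq.2.1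
        · filter_upwards [continuousAt_const.eventually_lt c1 (not_le.1 h)] with q hq hpq
          exact hq.not_ge hpq.1
      filter_upwards [hev] with q hq
      rw [indicator_of_notMem hq]

open BoundedContinuousFunction in
/-- Existence: in the unknown `k(s,t) = (w s / w t) K(s,t)`, for a suitable exponential weight `w`,
the equation is a contraction of the closed unit ball of bounded continuous functions. -/
theorem exists_continuous_solution (𝕜 : Type*) [RCLike 𝕜] (hν : ν.variation ≤ μ.prod μ) :
    ∃ K : ℝ → ℝ → 𝕜, Continuous (fun p : ℝ × ℝ => K p.1 p.2) ∧
      ∀ s t, s ≤ t →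
        K s t = 1 - ∫ᵛ p in orderedPairs s t, K s p.1 * K p.1 p.2 ∂<•ν := by
  have := isFiniteMeasure_variation_of_le_prod hν
  obtain ⟨w, hwc, hwm, hwpos, hw⟩ := exists_weight_setIntegral_orderedPairs_le hν
  have hw0 : ∀ t, w t ≠ 0 := fun t => (hwpos t).ne'
  have hwint : ∀ s t, IntegrableOn (fun p : ℝ × ℝ => w p.2) (orderedPairs s t) ν.variation :=
    fun s t => (Continuous.continuousOn (by fun_prop)).integrableOn_compact
      (isCompact_orderedPairs s t)
  have hle : ∀ (s t : ℝ) (f : ℝ × ℝ → 𝕜) (C : ℝ), s ≤ t → 0 ≤ C →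
      (∀ p ∈ orderedPairs s t, ‖f p‖ ≤ C * (w p.2 / w t)) →
      ‖∫ᵛ p in orderedPairs s t, f p ∂<•ν‖ ≤ C * (1 / 4 * (1 - w s / w t)) := by
    intro s t f C hst hC hf
    calc ‖∫ᵛ p in orderedPairs s t, f p ∂<•ν‖
        ≤ ∫ p in orderedPairs s t, ‖f p‖ ∂ν.variation :=
          VectorMeasure.norm_setIntegral_le_setIntegral_norm ν (measurableSet_orderedPairs s t) f
      _ ≤ ∫ p in orderedPairs s t, C / w t * w p.2 ∂ν.variation := by
          refine integral_mono_of_nonneg (.of_forall fun p => norm_nonneg _)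
            ((hwint s t).const_mul _) ?_
          refine (ae_restrict_iff' (measurableSet_orderedPairs s t)).2 (.of_forall fun p hp => ?_)
          refine (hf p hp).trans (le_of_eq ?_)
          ring
      _ = C / w t * ∫ p in orderedPairs s t, w p.2 ∂ν.variation := integral_const_mul _ _
      _ ≤ C / w t * (1 / 4 * (w t - w s)) := by
          have := (hwpos t).le
          gcongr
          exact hw s t hst
      _ = C * (1 / 4 * (1 - w s / w t)) := by have := hw0 t; field_simp
  -- The weight left over: `(w s / w t) * (w u / w s) * (w r / w u) = w r / w t`.
  let g : (ℝ × ℝ →ᵇ 𝕜) → ℝ × ℝ → ℝ × ℝ → 𝕜 := fun k q p =>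
    (w p.2 / w q.2) • (k (q.1, p.1) * k p)
  have hgc : ∀ k, Continuous fun x : (ℝ × ℝ) × (ℝ × ℝ) => g k x.1 x.2 := fun k => by
    have h1 : Continuous fun x : (ℝ × ℝ) × (ℝ × ℝ) => w x.2.2 / w x.1.2 :=
      Continuous.div (by fun_prop) (by fun_prop) fun x => hw0 _
    have h2 : Continuous fun x : (ℝ × ℝ) × (ℝ × ℝ) => k (x.1.1, x.2.1) * k x.2 := by fun_prop
    exact h1.smul h2
  have hgn : ∀ k q p, ‖g k q p‖ ≤ ‖k‖ ^ 2 * (w p.2 / w q.2) := fun k q p => by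
    have h0 : 0 ≤ w p.2 / w q.2 := (div_pos (hwpos _) (hwpos _)).le
    rw [norm_smul, Real.norm_of_nonneg h0, norm_mul, mul_comm, sq]
    gcongr
    · exact k.norm_coe_le_norm _
    · exact k.norm_coe_le_norm _
  have hgI : ∀ k (q : ℝ × ℝ), IntegrableOn (g k q) (orderedPairs q.1 q.2) ν.variation :=
    fun k q => ((hgc k).comp (Continuous.prodMk continuous_const
      continuous_id)).continuousOn.integrableOn_compact (isCompact_orderedPairs _ _)
  let J : (ℝ × ℝ →ᵇ 𝕜) → ℝ × ℝ → 𝕜 := fun k q =>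
    ∫ᵛ p in orderedPairs q.1 q.2, g k q p ∂<•ν
  have hJc : ∀ k, Continuous (J k) := fun k => by
    refine continuous_setIntegral_orderedPairs hν (hgc k) (C := ‖k‖ ^ 2) (by positivity) ?_
    intro q p hp
    refine (hgn k q p).trans (mul_le_of_le_one_right (by positivity) ?_)
    exact (div_le_one (hwpos _)).2 (hwm hp.2.2)
  have hratio : ∀ s t, s ≤ t → 0 ≤ w s / w t ∧ w s / w t ≤ 1 := fun s t hst =>
    ⟨(div_pos (hwpos _) (hwpos _)).le, (div_le_one (hwpos _)).2 (hwm hst)⟩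
  have hJn : ∀ k (q : ℝ × ℝ), q.1 ≤ q.2 →
      ‖J k q‖ ≤ ‖k‖ ^ 2 * (1 / 4 * (1 - w q.1 / w q.2)) := fun k q hq =>
    hle _ _ _ _ hq (by positivity) fun p _ => hgn k q p
  -- Retraction onto `s ≤ t`, so that `Φ k` lives on the whole plane and stays bounded: `w s / w t ≤
  -- 1` may fail for `s > t`.
  let ρ : ℝ × ℝ → ℝ × ℝ := fun q => (q.1, max q.1 q.2)
  have hρ : Continuous ρ := by fun_prop
  have hρle : ∀ q, (ρ q).1 ≤ (ρ q).2 := fun q => le_max_left _ _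
  let Ψ : (ℝ × ℝ →ᵇ 𝕜) → ℝ × ℝ → 𝕜 := fun k q => ((w q.1 / w q.2 : ℝ) : 𝕜) - J k q
  have hΨc : ∀ k, Continuous (Ψ k) := fun k => by
    have h1 : Continuous fun x : ℝ × ℝ => w x.1 / w x.2 :=
      Continuous.div (by fun_prop) (by fun_prop) fun x => hw0 _
    exact (RCLike.continuous_ofReal.comp h1).sub (hJc k)
  have hΨn : ∀ k (q : ℝ × ℝ), q.1 ≤ q.2 →
      ‖Ψ k q‖ ≤ w q.1 / w q.2 + ‖k‖ ^ 2 * (1 / 4 * (1 - w q.1 / w q.2)) := fun k q hq => by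
    refine (norm_sub_le _ _).trans (add_le_add (le_of_eq ?_) (hJn k q hq))
    rw [RCLike.norm_ofReal, abs_of_nonneg (hratio _ _ hq).1]
  let Φ : (ℝ × ℝ →ᵇ 𝕜) → (ℝ × ℝ →ᵇ 𝕜) := fun k =>
    BoundedContinuousFunction.ofNormedAddCommGroup (fun q => Ψ k (ρ q)) ((hΨc k).comp hρ)
      (1 + ‖k‖ ^ 2) fun q => by
        obtain ⟨h1, h2⟩ := hratio _ _ (hρle q)
        refine (hΨn k _ (hρle q)).trans (add_le_add h2 ?_)
        exact mul_le_of_le_one_right (by positivity) (by linarith)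
  have hmaps : MapsTo Φ (Metric.closedBall 0 1) (Metric.closedBall 0 1) := by
    intro k hk
    rw [mem_closedBall_zero_iff] at hk ⊢
    refine (BoundedContinuousFunction.norm_le zero_le_one).2 fun q => ?_
    obtain ⟨h1, h2⟩ := hratio _ _ (hρle q)
    refine (hΨn k _ (hρle q)).trans ?_
    -- With `θ = w s / w t ∈ [0, 1]`, the bound is `θ + (1 - θ) / 4 ≤ 1`.
    have : ‖k‖ ^ 2 ≤ 1 := pow_le_one₀ (norm_nonneg _) hk
    nlinarith
  -- `1 / 2` is the `1 / 4` of the weight times the two terms in the difference of products.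
  have hcontr : ContractingWith (1 / 2) (hmaps.restrict Φ _ _) := by
    refine ⟨by norm_num, LipschitzWith.of_dist_le_mul ?_⟩
    rintro ⟨k, hk⟩ ⟨l, hl⟩
    rw [mem_closedBall_zero_iff] at hk hl
    change dist (Φ k) (Φ l) ≤ _ * dist k l
    rw [dist_eq_norm, dist_eq_norm]
    refine (BoundedContinuousFunction.norm_le (by positivity)).2 fun q => ?_
    have hq := hρle q
    obtain ⟨h1, h2⟩ := hratio _ _ hq
    have e : (Φ k - Φ l) q =
        -∫ᵛ p in orderedPairs (ρ q).1 (ρ q).2, (g k (ρ q) p - g l (ρ q) p) ∂<•ν := by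
      rw [VectorMeasure.integral_fun_sub
        ((VectorMeasure.integrableOn_iff_variation (measurableSet_orderedPairs _ _)).2 (hgI k (ρ q)))
        ((VectorMeasure.integrableOn_iff_variation (measurableSet_orderedPairs _ _)).2 (hgI l (ρ q)))]
      change Ψ k (ρ q) - Ψ l (ρ q) = _
      simp only [Ψ, J]
      ring
    rw [e, norm_neg]
    refine (hle _ _ _ (2 * ‖k - l‖) hq (by positivity) fun p _ => ?_).trans ?_
    · have h0 : 0 ≤ w p.2 / w (ρ q).2 := (div_pos (hwpos _) (hwpos _)).le
      have e' : g k (ρ q) p - g l (ρ q) p = (w p.2 / w (ρ q).2) •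
          (k ((ρ q).1, p.1) * (k - l) p + (k - l) ((ρ q).1, p.1) * l p) := by
        simp only [g, ← smul_sub, BoundedContinuousFunction.sub_apply]
        congr 1
        ring
      rw [e', norm_smul, Real.norm_of_nonneg h0, mul_comm]
      gcongr
      refine (norm_add_le _ _).trans ?_
      rw [norm_mul, norm_mul]
      have a1 := (k.norm_coe_le_norm ((ρ q).1, p.1)).trans hk
      have a2 := (l.norm_coe_le_norm p).trans hl
      have a3 := (k - l).norm_coe_le_norm p
      have a4 := (k - l).norm_coe_le_norm ((ρ q).1, p.1)
      have a5 := mul_le_mul a1 a3 (norm_nonneg _) zero_le_one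
      have a6 := mul_le_mul a4 a2 (norm_nonneg _) (norm_nonneg _)
      linarith
    · have : ((1 / 2 : NNReal) : ℝ) = 1 / 2 := by norm_num
      rw [this]
      nlinarith [norm_nonneg (k - l)]
  obtain ⟨k, -, hk, -⟩ := hcontr.exists_fixedPoint' Metric.isClosed_closedBall.isComplete hmaps
    (x := 0) (by simp) (edist_ne_top _ _)
  refine ⟨fun s t => ((w t / w s : ℝ) : 𝕜) * k (s, t), ?_, fun s t hst => ?_⟩
  · have h1 : Continuous fun x : ℝ × ℝ => w x.2 / w x.1 :=
      Continuous.div (by fun_prop) (by fun_prop) fun x => hw0 _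
    exact (RCLike.continuous_ofReal.comp h1).mul k.continuous
  · have hkst : k (s, t) = ((w s / w t : ℝ) : 𝕜) - J k (s, t) := by
      conv_lhs => rw [← hk.eq]
      change Ψ k (ρ (s, t)) = _
      simp only [ρ, max_eq_right hst, Ψ]
    have hJ : ((w t / w s : ℝ) : 𝕜) * J k (s, t) = ∫ᵛ p in orderedPairs s t,
        (((w p.1 / w s : ℝ) : 𝕜) * k (s, p.1)) * (((w p.2 / w p.1 : ℝ) : 𝕜) * k (p.1, p.2))
          ∂<•ν := by
      rw [← RCLike.real_smul_eq_coe_mul]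
      simp only [J]
      rw [← VectorMeasure.integral_fun_smul]
      refine VectorMeasure.setIntegral_congr_fun fun p _ => ?_
      simp only [g, RCLike.real_smul_eq_coe_mul]
      have a : (w s : 𝕜) ≠ 0 := by exact_mod_cast hw0 s
      have b : (w t : 𝕜) ≠ 0 := by exact_mod_cast hw0 t
      have c : (w p.1 : 𝕜) ≠ 0 := by exact_mod_cast hw0 p.1
      push_cast
      field_simp
    change ((w t / w s : ℝ) : 𝕜) * k (s, t) = _
    rw [← hJ, hkst, mul_sub]
    congr 1
    have a : (w s : 𝕜) ≠ 0 := by exact_mod_cast hw0 s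
    have b : (w t : 𝕜) ≠ 0 := by exact_mod_cast hw0 t
    push_cast
    field_simp

end Existence

/-! ### Uniqueness among all solutions. -/

/-- `K` satisfies `K(s,t) = 1 - ∫_s^t ∫_s^r K(s,u) K(u,r) dν(u,r)` on `0 ≤ s ≤ t ≤ T`, with
absolutely convergent integrals. -/
structure IsQuadraticVolterraSolution {𝕜 : Type*} [RCLike 𝕜] (ν : SignedMeasure (ℝ × ℝ)) (T : ℝ)
    (K : ℝ → ℝ → 𝕜) : Prop where
  integrableOn : ∀ s t : ℝ, 0 ≤ s → s ≤ t → t ≤ T →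
    IntegrableOn (fun p : ℝ × ℝ => K s p.1 * K p.1 p.2) (orderedPairs s t) ν.variation
  eq_one_sub : ∀ s t : ℝ, 0 ≤ s → s ≤ t → t ≤ T →
    K s t = 1 - ∫ᵛ p in orderedPairs s t, K s p.1 * K p.1 p.2 ∂<•ν

/-- The strips decrease to the empty set as `τ ↓ σ`, because they are open at `σ`. -/
theorem exists_setIntegral_strip_lt {N : Measure (ℝ × ℝ)} {b σ ε : ℝ} (hσ : σ < b) (hε : 0 < ε)
    {g : ℝ × ℝ → ℝ} (hg : IntegrableOn g (orderedPairs 0 b) N) :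
    ∃ τ ∈ Ioc σ b, ∫ p in orderedPairs 0 b ∩ {p | p.2 ∈ Ioc σ τ}, g p ∂N < ε := by
  set A : ℕ → Set (ℝ × ℝ) := fun n =>
    orderedPairs 0 b ∩ {p | p.2 ∈ Ioc σ (σ + (b - σ) * (1 / ((n : ℝ) + 1)))} with hA
  have hb : 0 < b - σ := sub_pos.2 hσ
  have hAm : ∀ n, MeasurableSet (A n) := fun n =>
    (measurableSet_orderedPairs 0 b).inter (measurable_snd measurableSet_Ioc)
  have hanti : Antitone A := fun i j hij p hp => by
    refine ⟨hp.1, hp.2.1, hp.2.2.trans ?_⟩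
    have := one_div_le_one_div_of_le (by positivity)
      (add_le_add_left (Nat.cast_le (α := ℝ).2 hij) 1)
    gcongr
  have hlim := tendsto_setIntegral_of_antitone hAm hanti ⟨0, hg.mono_set inter_subset_left⟩
  have hlim0 : Tendsto (fun n : ℕ => σ + (b - σ) * (1 / ((n : ℝ) + 1))) atTop (𝓝 σ) := by
    simpa using (tendsto_one_div_add_atTop_nhds_zero_nat (𝕜 := ℝ)).const_mul (b - σ) |>.const_add σ
  have hempty : ⋂ n, A n = ∅ := by
    refine eq_empty_of_forall_notMem fun p hp => ?_
    rw [mem_iInter] at hp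
    exact (ge_of_tendsto' hlim0 fun n => (hp n).2.2).not_gt (hp 0).2.1
  rw [hempty, setIntegral_empty] at hlim
  obtain ⟨n, hn⟩ := (hlim.eventually_lt_const hε).exists
  refine ⟨_, ⟨?_, ?_⟩, hn⟩
  · have : 0 < (b - σ) * (1 / ((n : ℝ) + 1)) := by positivity
    linarith
  · have : 1 / ((n : ℝ) + 1) ≤ 1 := by
      rw [div_le_one (by positivity)]
      linarith [Nat.cast_nonneg (α := ℝ) n]
    nlinarith

/-- Passes from integrability of `K(s,u) K(u,r)` to that of `K(u,r)`, with `g = K s`. -/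
theorem integrableOn_of_half_le_norm_mul {𝕜 : Type*} [RCLike 𝕜] {N : Measure (ℝ × ℝ)}
    {A : Set (ℝ × ℝ)} (hA : MeasurableSet A) {a b : ℝ} (hAab : ∀ p ∈ A, p.1 ∈ Icc a b) {g : ℝ → 𝕜}
    (hg : ContinuousOn g (Icc a b)) (hg2 : ∀ u ∈ Icc a b, 1 / 2 ≤ ‖g u‖) {k : ℝ × ℝ → 𝕜}
    (h : IntegrableOn (fun p => g p.1 * k p) A N) : IntegrableOn k A N := by
  have hg0 : ∀ u ∈ Icc a b, g u ≠ 0 := fun u hu => by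
    have := hg2 u hu
    exact norm_pos_iff.1 (by linarith)
  have hc : ContinuousOn (fun p : ℝ × ℝ => (g p.1)⁻¹) A :=
    (hg.comp continuousOn_fst hAab).inv₀ fun p hp => hg0 _ (hAab p hp)
  have hb : ∀ᵐ p ∂N.restrict A, ‖(g p.1)⁻¹‖ ≤ 2 :=
    (ae_restrict_iff' hA).2 <| .of_forall fun p hp => by
      rw [norm_inv]
      exact inv_le_of_inv_le₀ (by norm_num) (by linarith [hg2 _ (hAab p hp)])
  refine (Integrable.bdd_mul h (hc.aestronglyMeasurable hA) hb).congr ?_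
  refine (ae_restrict_iff' hA).2 <| .of_forall fun p hp => ?_
  exact inv_mul_cancel_left₀ (hg0 _ (hAab p hp)) _

namespace IsQuadraticVolterraSolution

variable {𝕜 : Type*} [RCLike 𝕜] {μ : Measure ℝ} [IsFiniteMeasure μ] [NullSingletonClass μ]
  {ν : SignedMeasure (ℝ × ℝ)} {T : ℝ} {K K₁ K₂ : ℝ → ℝ → 𝕜}

/-- The domain of integration shrinks to the point `(s, s)`, which lies on a null line. -/
theorem diag (hK : IsQuadraticVolterraSolution ν T K) (hν : ν.variation ≤ μ.prod μ) {s : ℝ}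
    (hs : 0 ≤ s) (hsT : s ≤ T) : K s s = 1 := by
  rw [hK.eq_one_sub s s hs le_rfl hsT, VectorMeasure.setIntegral_of_variation_apply_eq_zero,
    sub_zero]
  refine measure_mono_null (fun p (hp : p ∈ orderedPairs s s) => ?_) (ae_fst_ne hν s)
  exact fun h => h (le_antisymm (hp.2.1.trans hp.2.2) hp.1)

theorem sub_eq (hK : IsQuadraticVolterraSolution ν T K) {s m t : ℝ} (hs : 0 ≤ s) (hsm : s ≤ m)
    (hmt : m ≤ t) (ht : t ≤ T) :
    K s t = K s m - ∫ᵛ p in orderedPairs s t \ orderedPairs s m, K s p.1 * K p.1 p.2 ∂<•ν := by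
  rw [VectorMeasure.setIntegral_sdiff (measurableSet_orderedPairs s t)
    (measurableSet_orderedPairs s m)
    ((VectorMeasure.integrableOn_iff_variation (measurableSet_orderedPairs s t)).2
      (hK.integrableOn s t hs (hsm.trans hmt) ht)) (orderedPairs_subset le_rfl hmt),
    hK.eq_one_sub s t hs (hsm.trans hmt) ht, hK.eq_one_sub s m hs hsm (hmt.trans ht)]
  ring

/-- For fixed `s` the integrand does not depend on `t`; only the domain does. The integrand on the
domain for `t = T` dominates, and the indicators converge off the null line `p.2 = t₀`. -/
theorem continuousOn_right (hK : IsQuadraticVolterraSolution ν T K) (hν : ν.variation ≤ μ.prod μ)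
    {s : ℝ} (hs : 0 ≤ s) : ContinuousOn (K s) (Icc s T) := by
  intro t₀ ht₀
  have hsT : s ≤ T := ht₀.1.trans ht₀.2
  set f : ℝ × ℝ → 𝕜 := fun p => K s p.1 * K p.1 p.2
  have hf := hK.integrableOn s T hs hsT le_rfl
  have h : ContinuousWithinAt
      (fun t => ∫ᵛ p, (orderedPairs s t).indicator f p ∂<•ν) (Icc s T) t₀ := by
    refine VectorMeasure.continuousWithinAt_of_dominated
      (bound := (orderedPairs s T).indicator fun p => ‖f p‖) ?_ ?_
      ((integrable_indicator_iff (measurableSet_orderedPairs s T)).2 hf.norm) ?_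
    · filter_upwards [self_mem_nhdsWithin] with t ht
      exact ((hf.mono_set (orderedPairs_subset le_rfl ht.2)).integrable_indicator
        (measurableSet_orderedPairs s t)).aestronglyMeasurable
    · filter_upwards [self_mem_nhdsWithin] with t ht
      refine .of_forall fun p => ?_
      rw [norm_indicator_eq_indicator_norm]
      exact indicator_le_indicator_of_subset (orderedPairs_subset le_rfl ht.2)
        (fun _ => norm_nonneg _) p
    · filter_upwards [ae_snd_ne hν t₀] with p hp
      refine ContinuousAt.continuousWithinAt ?_
      have hev : ∀ᶠ t in 𝓝 t₀, (p ∈ orderedPairs s t ↔ p ∈ orderedPairs s t₀) := by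
        rcases lt_or_gt_of_ne hp with hp | hp
        · filter_upwards [lt_mem_nhds hp] with t ht
          exact ⟨fun h => ⟨h.1, h.2.1, hp.le⟩, fun h => ⟨h.1, h.2.1, ht.le⟩⟩
        · filter_upwards [gt_mem_nhds hp] with t ht
          exact ⟨fun h => absurd h.2.2 ht.not_ge, fun h => absurd h.2.2 hp.not_ge⟩
      refine (continuousAt_const (y := (orderedPairs s t₀).indicator f p)).congr ?_
      filter_upwards [hev] with t ht
      by_cases h : p ∈ orderedPairs s t₀
      · rw [indicator_of_mem h, indicator_of_mem (ht.2 h)]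
      · rw [indicator_of_notMem h, indicator_of_notMem fun h' => h (ht.1 h')]
  have hE : ∀ t ∈ Icc s T, K s t = 1 - ∫ᵛ p, (orderedPairs s t).indicator f p ∂<•ν := by
    intro t ht
    rw [VectorMeasure.integral_indicator (measurableSet_orderedPairs s t)]
    exact hK.eq_one_sub s t hs ht.1 ht.2
  exact (continuousWithinAt_const.sub h).congr hE (hE t₀ ht₀)

/-- A solution bounded by `M` up to time `σ` is bounded by `2 * M` up to time `τ` if its own mass on
the strip `σ < r ≤ τ` is at most `1 / 2`. -/
theorem norm_le_of_setIntegral_strip_le (hK : IsQuadraticVolterraSolution ν T K)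
    (hν : ν.variation ≤ μ.prod μ) {b σ τ M : ℝ} (hb : b ≤ T) (hτb : τ ≤ b) (hM : 1 ≤ M)
    (hKM : ∀ s t, 0 ≤ s → s ≤ t → t ≤ σ → ‖K s t‖ ≤ M)
    (hint : IntegrableOn (fun p : ℝ × ℝ => K p.1 p.2) (orderedPairs 0 b) ν.variation)
    (hstrip : ∫ p in orderedPairs 0 b ∩ {p | p.2 ∈ Ioc σ τ}, ‖K p.1 p.2‖ ∂ν.variation ≤ 1 / 2)
    {s t : ℝ} (hs : 0 ≤ s) (hst : s ≤ t) (ht : t ≤ τ) : ‖K s t‖ ≤ 2 * M := by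
  -- Continuity in `t` makes the maximum `B` over `[s, τ]` finite, so `B ≤ M + B / 2` can be solved
  -- for `B`.
  obtain ⟨t', ht', hmax⟩ := isCompact_Icc.exists_isMaxOn (nonempty_Icc.2 (hst.trans ht))
    ((hK.continuousOn_right hν hs).mono (Icc_subset_Icc_right (hτb.trans hb))).norm
  set B := ‖K s t'‖
  have hB : 0 ≤ B := norm_nonneg _
  refine (hmax ⟨hst, ht⟩ : ‖K s t‖ ≤ B).trans ?_
  -- The last time in `[s, t']` not after `σ`, or `s` if `σ < s`; in that case `K s s = 1 ≤ M`.
  set m := max s (min σ t')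
  have hmt : m ≤ t' := max_le ht'.1 (min_le_right _ _)
  have hm : ‖K s m‖ ≤ M := by
    rcases le_total m σ with h | h
    · exact hKM s m hs (le_max_left _ _) h
    · rcases le_total (min σ t') s with h' | h'
      · have : m = s := max_eq_left h'
        rw [this, hK.diag hν hs (ht'.1.trans (ht'.2.trans (hτb.trans hb))), norm_one]
        exact hM
      · refine hKM s m hs (le_max_left _ _) ?_
        rw [show m = min σ t' from max_eq_right h']
        exact min_le_left _ _
  set S := orderedPairs 0 b ∩ {p | p.2 ∈ Ioc σ τ}
  have hS : MeasurableSet S :=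
    (measurableSet_orderedPairs 0 b).inter (measurable_snd measurableSet_Ioc)
  have hA : MeasurableSet (orderedPairs s t' \ orderedPairs s m) :=
    (measurableSet_orderedPairs s t').diff (measurableSet_orderedPairs s m)
  have hAS : orderedPairs s t' \ orderedPairs s m ⊆ S := by
    rintro p ⟨hp, hpm⟩
    refine ⟨orderedPairs_subset hs (ht'.2.trans hτb) hp, ?_, hp.2.2.trans ht'.2⟩
    by_contra h
    exact hpm ⟨hp.1, hp.2.1, le_max_of_le_right (le_min (not_lt.1 h) hp.2.2)⟩
  have hintS : IntegrableOn (fun p : ℝ × ℝ => B * ‖K p.1 p.2‖) S ν.variation :=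
    (hint.mono_set inter_subset_left).norm.const_mul B
  have key : ‖∫ᵛ p in orderedPairs s t' \ orderedPairs s m, K s p.1 * K p.1 p.2 ∂<•ν‖ ≤
      B * (1 / 2) := by
    calc _ ≤ ∫ p in orderedPairs s t' \ orderedPairs s m, ‖K s p.1 * K p.1 p.2‖ ∂ν.variation :=
          VectorMeasure.norm_setIntegral_le_setIntegral_norm ν hA _
      _ ≤ ∫ p in orderedPairs s t' \ orderedPairs s m, B * ‖K p.1 p.2‖ ∂ν.variation := by
          refine integral_mono_of_nonneg (.of_forall fun p => norm_nonneg _)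
            (hintS.mono_set hAS) ?_
          refine (ae_restrict_iff' hA).2 (.of_forall fun p hp => ?_)
          simp only [norm_mul]
          gcongr
          exact hmax (⟨hp.1.1, hp.1.2.1.trans (hp.1.2.2.trans ht'.2)⟩ : p.1 ∈ Icc s τ)
      _ ≤ ∫ p in S, B * ‖K p.1 p.2‖ ∂ν.variation :=
          setIntegral_mono_set hintS (.of_forall fun p => by positivity) hAS.eventuallyLE
      _ = B * ∫ p in S, ‖K p.1 p.2‖ ∂ν.variation := integral_const_mul _ _
      _ ≤ B * (1 / 2) := by gcongr
  have : B ≤ M + B * (1 / 2) := by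
    calc B = ‖K s m - ∫ᵛ p in orderedPairs s t' \ orderedPairs s m,
          K s p.1 * K p.1 p.2 ∂<•ν‖ := by
          rw [← hK.sub_eq hs (le_max_left _ _) hmt (ht'.2.trans (hτb.trans hb))]
      _ ≤ _ := (norm_sub_le _ _).trans (add_le_add hm key)
  linarith

/-- Two bounded solutions which agree up to time `σ` satisfy a contraction estimate on a strip
`σ < r ≤ τ` of small mass. -/
theorem norm_sub_le_half (hK₁ : IsQuadraticVolterraSolution ν T K₁)
    (hK₂ : IsQuadraticVolterraSolution ν T K₂)
    (hν : ν.variation ≤ μ.prod μ) {b σ τ M C : ℝ} (hb : b ≤ T) (hτb : τ ≤ b) (hC : 0 ≤ C)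
    (hM : 0 ≤ M)
    (hK₁M : ∀ s t, 0 ≤ s → s ≤ t → t ≤ τ → ‖K₁ s t‖ ≤ M)
    (hK₂M : ∀ s t, 0 ≤ s → s ≤ t → t ≤ τ → ‖K₂ s t‖ ≤ 2 * M)
    (heq : ∀ s t, 0 ≤ s → s ≤ t → t ≤ σ → K₂ s t = K₁ s t)
    (hstrip : 6 * M * ν.variation.real (orderedPairs 0 b ∩ {p | p.2 ∈ Ioc σ τ}) ≤ 1)
    (hD : ∀ s t, 0 ≤ s → s ≤ t → t ≤ τ → ‖K₂ s t - K₁ s t‖ ≤ C)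
    {s t : ℝ} (hs : 0 ≤ s) (hst : s ≤ t) (ht : t ≤ τ) : ‖K₂ s t - K₁ s t‖ ≤ C * (1 / 2) := by
  have := isFiniteMeasure_variation_of_le_prod hν
  set m := max s (min σ t)
  have hmt : m ≤ t := max_le hst (min_le_right _ _)
  have htT : t ≤ T := ht.trans (hτb.trans hb)
  have hm : K₂ s m = K₁ s m := by
    rcases le_total (min σ t) s with h' | h'
    · have : m = s := max_eq_left h'
      rw [this, hK₁.diag hν hs (hst.trans htT), hK₂.diag hν hs (hst.trans htT)]
    · refine heq s m hs (le_max_left _ _) ?_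
      rw [show m = min σ t from max_eq_right h']
      exact min_le_left _ _
  set A := orderedPairs s t \ orderedPairs s m
  set S := orderedPairs 0 b ∩ {p | p.2 ∈ Ioc σ τ}
  have hA : MeasurableSet A :=
    (measurableSet_orderedPairs s t).diff (measurableSet_orderedPairs s m)
  have hAS : A ⊆ S := by
    rintro p ⟨hp, hpm⟩
    refine ⟨orderedPairs_subset hs (ht.trans hτb) hp, ?_, hp.2.2.trans ht⟩
    by_contra h
    exact hpm ⟨hp.1, hp.2.1, le_max_of_le_right (le_min (not_lt.1 h) hp.2.2)⟩
  have hI : ∀ K : ℝ → ℝ → 𝕜, IsQuadraticVolterraSolution ν T K →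
      ν.IntegrableOn (fun p : ℝ × ℝ => K s p.1 * K p.1 p.2) A := fun K hK =>
    (VectorMeasure.integrableOn_iff_variation hA).2
      ((hK.integrableOn s t hs hst htT).mono_set sdiff_subset)
  have e : K₂ s t - K₁ s t =
      -∫ᵛ p in A, (K₂ s p.1 * K₂ p.1 p.2 - K₁ s p.1 * K₁ p.1 p.2) ∂<•ν := by
    rw [VectorMeasure.integral_fun_sub (hI K₂ hK₂) (hI K₁ hK₁),
      hK₁.sub_eq hs (le_max_left _ _) hmt htT, hK₂.sub_eq hs (le_max_left _ _) hmt htT, hm]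
    ring
  rw [e, norm_neg]
  calc _ ≤ ∫ p in A, ‖K₂ s p.1 * K₂ p.1 p.2 - K₁ s p.1 * K₁ p.1 p.2‖ ∂ν.variation :=
        VectorMeasure.norm_setIntegral_le_setIntegral_norm ν hA _
    -- `3 * M` is `2 * M` from `K₂` plus `M` from `K₁` in the product rule.
    _ ≤ ∫ p in A, 3 * M * C ∂ν.variation := by
        refine integral_mono_of_nonneg (.of_forall fun p => norm_nonneg _)
          (integrable_const _) ?_
        refine (ae_restrict_iff' hA).2 (.of_forall fun p hp => ?_)
        have e' : K₂ s p.1 * K₂ p.1 p.2 - K₁ s p.1 * K₁ p.1 p.2 =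
          K₂ s p.1 * (K₂ p.1 p.2 - K₁ p.1 p.2) + (K₂ s p.1 - K₁ s p.1) * K₁ p.1 p.2 := by ring
        have h1 : p.1 ≤ τ := hp.1.2.1.trans (hp.1.2.2.trans ht)
        have h2 : 0 ≤ p.1 := hs.trans hp.1.1
        have h3 : p.2 ≤ τ := hp.1.2.2.trans ht
        have a := mul_le_mul (hK₂M s p.1 hs hp.1.1 h1) (hD p.1 p.2 h2 hp.1.2.1 h3)
          (norm_nonneg _) (by positivity)
        have b := mul_le_mul (hD s p.1 hs hp.1.1 h1) (hK₁M p.1 p.2 h2 hp.1.2.1 h3)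
          (norm_nonneg _) hC
        simp only [e']
        refine (norm_add_le _ _).trans ?_
        rw [norm_mul, norm_mul]
        linarith
    _ = 3 * M * C * ν.variation.real A := by simp [mul_comm]
    _ ≤ 3 * M * C * ν.variation.real S :=
        mul_le_mul_of_nonneg_left (measureReal_mono hAS (measure_ne_top _ _)) (by positivity)
    _ = C * (1 / 2) * (6 * M * ν.variation.real S) := by ring
    _ ≤ C * (1 / 2) := mul_le_of_le_one_right (by positivity) hstrip

theorem exists_eq_extension (hK₁ : IsQuadraticVolterraSolution ν T K₁)
    (hK₂ : IsQuadraticVolterraSolution ν T K₂) (hν : ν.variation ≤ μ.prod μ) {b σ M : ℝ}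
    (hb : b ≤ T) (hσb : σ < b) (hM : 1 ≤ M)
    (hK₁M : ∀ s t, 0 ≤ s → s ≤ t → t ≤ T → ‖K₁ s t‖ ≤ M)
    (heq : ∀ s t, 0 ≤ s → s ≤ t → t ≤ σ → K₂ s t = K₁ s t)
    (hint : IntegrableOn (fun p : ℝ × ℝ => K₂ p.1 p.2) (orderedPairs 0 b) ν.variation) :
    ∃ τ ∈ Ioc σ b, ∀ s t, 0 ≤ s → s ≤ t → t ≤ τ → K₂ s t = K₁ s t := by
  have := isFiniteMeasure_variation_of_le_prod hν
  -- Integrating `‖K₂‖ + 6 * M` lets one `τ` serve both the bound on `K₂` and the contraction, which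
  -- is then iterated from the crude bound `3 * M`.
  obtain ⟨τ, hτ, hlt⟩ := exists_setIntegral_strip_lt hσb (by norm_num : (0 : ℝ) < 1 / 2)
    (hint.norm.add (integrable_const (6 * M)))
  refine ⟨τ, hτ, ?_⟩
  have hadd : ∫ p in orderedPairs 0 b ∩ {p | p.2 ∈ Ioc σ τ}, ‖K₂ p.1 p.2‖ ∂ν.variation +
      6 * M * ν.variation.real (orderedPairs 0 b ∩ {p | p.2 ∈ Ioc σ τ}) < 1 / 2 := by
    refine lt_of_eq_of_lt ?_ hlt
    have h1 := integral_add (hint.mono_set (inter_subset_left (t := {p | p.2 ∈ Ioc σ τ}))).norm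
      (integrable_const (6 * M))
    refine Eq.trans ?_ h1.symm
    simp [mul_comm]
  have hpos : 0 ≤ ∫ p in orderedPairs 0 b ∩ {p | p.2 ∈ Ioc σ τ}, ‖K₂ p.1 p.2‖ ∂ν.variation :=
    integral_nonneg fun _ => norm_nonneg _
  have hpos' : 0 ≤ 6 * M * ν.variation.real (orderedPairs 0 b ∩ {p | p.2 ∈ Ioc σ τ}) := by
    positivity
  have hτT : τ ≤ T := hτ.2.trans hb
  have hK₁τ : ∀ s t, 0 ≤ s → s ≤ t → t ≤ τ → ‖K₁ s t‖ ≤ M := fun s t hs hst ht =>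
    hK₁M s t hs hst (ht.trans hτT)
  have hK₂τ : ∀ s t, 0 ≤ s → s ≤ t → t ≤ τ → ‖K₂ s t‖ ≤ 2 * M := fun s t hs hst ht =>
    hK₂.norm_le_of_setIntegral_strip_le hν hb hτ.2 hM
      (fun s t hs hst ht => by
        rw [heq s t hs hst ht]
        exact hK₁M s t hs hst (ht.trans (hσb.le.trans hb)))
      hint (by linarith) hs hst ht
  have hpow : ∀ n : ℕ, ∀ s t, 0 ≤ s → s ≤ t → t ≤ τ →
      ‖K₂ s t - K₁ s t‖ ≤ 3 * M * (1 / 2) ^ n := by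
    intro n
    induction n with
    | zero =>
      intro s t hs hst ht
      have := norm_sub_le (K₂ s t) (K₁ s t)
      linarith [hK₁τ s t hs hst ht, hK₂τ s t hs hst ht]
    | succ n ih =>
      intro s t hs hst ht
      rw [pow_succ, ← mul_assoc]
      exact norm_sub_le_half hK₁ hK₂ hν hb hτ.2 (by positivity) (by linarith) hK₁τ hK₂τ heq
        (by linarith) ih hs hst ht
  intro s t hs hst ht
  have hlim : Tendsto (fun n : ℕ => 3 * M * (1 / 2 : ℝ) ^ n) atTop (𝓝 0) := by
    simpa using (tendsto_pow_atTop_nhds_zero_of_lt_one (by norm_num : (0 : ℝ) ≤ 1 / 2)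
      (by norm_num)).const_mul (3 * M)
  exact sub_eq_zero.1 (norm_le_zero_iff.1 (ge_of_tendsto' hlim fun n => hpow n s t hs hst ht))

/-- A solution which agrees up to time `σ` with one that is at least `1 / 2` near the diagonal is
itself integrable beyond `σ`: divide the integrand `K(s,u) K(u,r)` by `K(s,u)` for `u` close to `s`,
moving `s` to the left in steps of length `ε`. -/
theorem exists_integrableOn_extension (hK₂ : IsQuadraticVolterraSolution ν T K₂) (hν : ν.variation ≤ μ.prod μ) {σ ε : ℝ}
    (hσ : 0 ≤ σ) (hσT : σ < T) (hε : 0 < ε)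
    (hK₁ε : ∀ s t, 0 ≤ s → s ≤ t → t ≤ T → t - s ≤ ε → 1 / 2 ≤ ‖K₁ s t‖)
    (heq : ∀ s t, 0 ≤ s → s ≤ t → t ≤ σ → K₂ s t = K₁ s t) :
    ∃ b ∈ Ioc σ T,
      IntegrableOn (fun p : ℝ × ℝ => K₂ p.1 p.2) (orderedPairs 0 b) ν.variation := by
  have hc := hK₂.continuousOn_right hν hσ
  -- Beyond `σ` nothing is known from `K₁`; the lower bound comes from `K₂ σ σ = 1` and continuity.
  have hev : ∀ᶠ t in 𝓝[Icc σ T] σ, 1 / 2 < ‖K₂ σ t‖ := by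
    refine (hc σ (left_mem_Icc.2 hσT.le)).norm.eventually_const_lt ?_
    simp only [hK₂.diag hν hσ hσT.le, norm_one]
    norm_num
  rw [nhdsWithin_Icc_eq_nhdsGE hσT] at hev
  obtain ⟨b, hbm, hb⟩ := (mem_nhdsGE_iff_exists_mem_Ioc_Ico_subset hσT).1 hev
  obtain ⟨b', hσb', hb'b⟩ := exists_between hbm.1
  have hb'T : b' ≤ T := hb'b.le.trans hbm.2
  refine ⟨b', ⟨hσb', hb'T⟩, ?_⟩
  have hbase : IntegrableOn (fun p : ℝ × ℝ => K₂ p.1 p.2) (orderedPairs σ b') ν.variation :=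
    integrableOn_of_half_le_norm_mul (measurableSet_orderedPairs σ b')
      (fun p hp => ⟨hp.1, hp.2.1.trans hp.2.2⟩) (hc.mono (Icc_subset_Icc_right hb'T))
      (fun u hu => (hb ⟨hu.1, hu.2.trans_lt hb'b⟩ : 1 / 2 < ‖K₂ σ u‖).le)
      (hK₂.integrableOn σ b' hσ hσb'.le hb'T)
  have hind : ∀ n : ℕ, IntegrableOn (fun p : ℝ × ℝ => K₂ p.1 p.2)
      (orderedPairs (max (σ - n * ε) 0) b') ν.variation := by
    intro n
    induction n with
    | zero => simpa [max_eq_left hσ] using hbase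
    | succ n ih =>
      set a := max (σ - n * ε) 0
      set a' := max (σ - (n + 1 : ℕ) * ε) 0
      have ha' : 0 ≤ a' := le_max_right _ _
      have haσ : a ≤ σ := max_le (by nlinarith [Nat.cast_nonneg (α := ℝ) n]) hσ
      have haa : a - a' ≤ ε := by
        have h1 : σ - (n + 1 : ℕ) * ε ≤ a' := le_max_left _ _
        push_cast at h1
        have : a ≤ a' + ε := max_le (by linarith) (by linarith)
        linarith
      have ha'σ : a' ≤ σ := max_le (by push_cast; nlinarith [Nat.cast_nonneg (α := ℝ) n]) hσ
      -- For `u ∈ [a', a]` one has `u ≤ σ` and `u - a' ≤ ε`, so `K₂ a' u = K₁ a' u` is at least `1 /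
      -- 2` in norm, while `r` may still exceed `σ`.
      have hleft : IntegrableOn (fun p : ℝ × ℝ => K₂ p.1 p.2)
          (orderedPairs a' b' ∩ {p | p.1 ≤ a}) ν.variation := by
        refine integrableOn_of_half_le_norm_mul (a := a') (b := a)
          ((measurableSet_orderedPairs a' b').inter (measurable_fst measurableSet_Iic))
          (fun p hp => ⟨hp.1.1, hp.2⟩) ((hK₂.continuousOn_right hν ha').mono
            (Icc_subset_Icc_right (haσ.trans hσT.le))) (fun u hu => ?_)
          ((hK₂.integrableOn a' b' ha' (ha'σ.trans hσb'.le) hb'T).mono_set inter_subset_left)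
        rw [heq a' u ha' hu.1 (hu.2.trans haσ)]
        exact hK₁ε a' u ha' hu.1 (hu.2.trans (haσ.trans hσT.le)) (by linarith [hu.2])
      refine (hleft.union ih).mono_set fun p hp => ?_
      rcases le_total p.1 a with h | h
      · exact Or.inl ⟨hp, h⟩
      · exact Or.inr ⟨h, hp.2⟩
  obtain ⟨n, hn⟩ := exists_nat_ge (σ / ε)
  have h0 : max (σ - n * ε) 0 = 0 := by
    refine max_eq_right ?_
    rw [div_le_iff₀ hε] at hn
    linarith
  exact h0 ▸ hind n

/-- Uniqueness: every solution agrees with a continuous one. -/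
theorem eq_of_continuousOn (hK₁ : IsQuadraticVolterraSolution ν T K₁)
    (hK₁c : ContinuousOn (fun p : ℝ × ℝ => K₁ p.1 p.2) (orderedPairs 0 T))
    (hK₂ : IsQuadraticVolterraSolution ν T K₂) (hν : ν.variation ≤ μ.prod μ) {s t : ℝ}
    (hs : 0 ≤ s) (hst : s ≤ t) (ht : t ≤ T) : K₂ s t = K₁ s t := by
  have hT : 0 ≤ T := hs.trans (hst.trans ht)
  obtain ⟨M, hM⟩ := (isCompact_orderedPairs 0 T).exists_bound_of_continuousOn hK₁c
  have hK₁M : ∀ s t, 0 ≤ s → s ≤ t → t ≤ T → ‖K₁ s t‖ ≤ max M 1 := fun s t hs hst ht =>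
    (hM (s, t) ⟨hs, hst, ht⟩).trans (le_max_left _ _)
  obtain ⟨ε, hε, hK₁ε⟩ : ∃ ε > 0, ∀ s t, 0 ≤ s → s ≤ t → t ≤ T → t - s ≤ ε →
      1 / 2 ≤ ‖K₁ s t‖ := by
    -- Uniform continuity and `K₁ s s = 1` give one `ε` for all `s`.
    have huc := (isCompact_orderedPairs 0 T).uniformContinuousOn_of_continuous hK₁c
    obtain ⟨δ, hδ, h⟩ := Metric.uniformContinuousOn_iff.1 huc (1 / 2) (by norm_num)
    refine ⟨δ / 2, by positivity, fun s t hs hst ht hts => ?_⟩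
    have hd : dist (s, s) (s, t) < δ := by
      rw [Prod.dist_eq, dist_self, Real.dist_eq, abs_sub_comm, abs_of_nonneg (sub_nonneg.2 hst)]
      exact max_lt hδ (by linarith)
    have h1 := h (s, s) ⟨hs, le_rfl, hst.trans ht⟩ (s, t) ⟨hs, hst, ht⟩ hd
    simp only [hK₁.diag hν hs (hst.trans ht), dist_eq_norm] at h1
    have h2 := norm_sub_norm_le (1 : 𝕜) (K₁ s t)
    rw [norm_one] at h2
    linarith
  let P : Set ℝ := {σ | ∀ s t, 0 ≤ s → s ≤ t → t ≤ σ → K₂ s t = K₁ s t}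
  suffices h : Icc 0 T ⊆ P from h (right_mem_Icc.2 hT) s t hs hst ht
  refine IsClosed.Icc_subset_of_forall_exists_gt ?_ ?_ ?_
  -- Only `t = x` needs an argument: there both solutions are left limits of their values at `u <
  -- x`, or equal `1` if also `s = x`.
  · refine isClosed_of_closure_subset fun x hx => ?_
    have hxI : x ∈ Icc 0 T := closure_minimal inter_subset_right isClosed_Icc hx
    refine ⟨fun s t hs hst htx => ?_, hxI⟩
    have hlt : ∀ u, s ≤ u → u < x → K₂ s u = K₁ s u := fun u hsu hux => by
      obtain ⟨y, hy, hyP⟩ := mem_closure_iff_nhds.1 hx (Ioi u) (Ioi_mem_nhds hux)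
      exact hyP.1 s u hs hsu (le_of_lt hy)
    rcases htx.lt_or_eq with htx | rfl
    · exact hlt t hst htx
    rcases hst.lt_or_eq with hst | rfl
    · have : (𝓝[Ico s t] t).NeBot := by
        rw [nhdsWithin_Ico_eq_nhdsLT hst]
        infer_instance
      have hsub : Ico s t ⊆ Icc s T := fun u hu => ⟨hu.1, hu.2.le.trans hxI.2⟩
      have hmem : t ∈ Icc s T := ⟨hst.le, hxI.2⟩
      have c1 := ((hK₁.continuousOn_right hν hs) t hmem).mono hsub
      have c2 := ((hK₂.continuousOn_right hν hs) t hmem).mono hsub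
      refine tendsto_nhds_unique c2.tendsto (c1.tendsto.congr' ?_)
      filter_upwards [self_mem_nhdsWithin] with u hu
      exact (hlt u hu.1 hu.2).symm
    · rw [hK₁.diag hν hs hxI.2, hK₂.diag hν hs hxI.2]
  · intro s t hs hst ht
    obtain rfl : s = 0 := le_antisymm (hst.trans ht) hs
    obtain rfl : t = 0 := le_antisymm ht hst
    rw [hK₁.diag hν le_rfl hT, hK₂.diag hν le_rfl hT]
  · rintro σ ⟨hσ, hσI⟩ y (hy : σ < y)
    obtain ⟨b, hb, hint⟩ := exists_integrableOn_extension hK₂ hν hσI.1 hσI.2 hε hK₁ε hσ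
    obtain ⟨τ, hτ, h⟩ := exists_eq_extension hK₁ hK₂ hν hb.2 hb.1 (le_max_right _ _) hK₁M hσ hint
    exact ⟨min τ y, fun s t hs hst ht => h s t hs hst (ht.trans (min_le_left _ _)),
      lt_min hτ.1 hy, min_le_right _ _⟩

end IsQuadraticVolterraSolution

theorem mainTheorem2 {𝕜 : Type*} [RCLike 𝕜] {V : Type*} [NormedAddCommGroup V]
    [InnerProductSpace ℝ V] [FiniteDimensional ℝ V] {T : ℝ} (hT : 0 ≤ T) (γ : ℝ → V)
    (hcont : ContinuousOn γ (Icc 0 T)) (hγ : BoundedVariationOn γ (Icc 0 T)) :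
    ∃ K : ℝ → ℝ → 𝕜,
      SolvesFunctionalEquation hT hγ K ∧
      ContinuousOn (fun p : ℝ × ℝ => K p.1 p.2) (orderedPairs 0 T) ∧
      ∀ K' : ℝ → ℝ → 𝕜, SolvesFunctionalEquation hT hγ K' →
        ∀ s t : ℝ, 0 ≤ s → s ≤ t → t ≤ T → K' s t = K s t := by
  have hν := variation_innerPathMeasure_le hT hγ
  have := nullSingletonClass_variation_pathMeasure hT hγ hcont
  have := isFiniteMeasure_variation_of_le_prod hν
  obtain ⟨K, hKc, hK⟩ := exists_continuous_solution 𝕜 hν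
  have hsol : IsQuadraticVolterraSolution (innerPathMeasure hT hγ) T K := by
    refine ⟨fun s t _ _ _ => ?_, fun s t _ hst _ => hK s t hst⟩
    have h1 : Continuous fun p : ℝ × ℝ => K s p.1 :=
      hKc.comp (Continuous.prodMk continuous_const continuous_fst)
    exact (h1.mul hKc).continuousOn.integrableOn_compact (isCompact_orderedPairs s t)
  refine ⟨K, ⟨fun s t hs hst ht => ?_, hsol.eq_one_sub, fun s hs hsT => hsol.diag hν hs hsT⟩,
    hKc.continuousOn, fun K' hK' s t hs hst ht => ?_⟩
  · exact (VectorMeasure.integrableOn_iff_variation (measurableSet_orderedPairs s t)).2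
      (hsol.integrableOn s t hs hst ht)
  · refine hsol.eq_of_continuousOn hKc.continuousOn ⟨fun s t hs hst ht => ?_, hK'.eq_one_sub⟩ hν
      hs hst ht
    exact (VectorMeasure.integrableOn_iff_variation (measurableSet_orderedPairs s t)).1
      (hK'.integrableOn s t hs hst ht)
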